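/- Let $\mathcal{F}$ be the category whose objects are the finite sets $[n]=\{1,\dots,n\}$, $n\ge 0$, and whose morphisms are all functions. An $\mathcal{F}$-representation is a functor $V$ from $\mathcal{F}$ to the category of finite-dimensional $\mathbb{Q}$-vector spaces; write $V[n]$ for its value at $[n]$ and $Vf$ for the linear map induced by a function $f$. It is finitely generated if there are finitely many vectors $x_i\in V[k_i]$ such that every $V[n]$ is spanned by the vectors $(Vf)(x_i)$ with $f:[k_i]\to[n]$ an arbitrary function. A universal trace-computing polynomial for $V$ is a polynomial $\varphi(x_0,x_1,x_2,\dots)$ with rational coefficients (involving only finitely many of the variables) such that for every $n>0$ and every function $f:[n]\to[n]$, $$\operatorname{Tr}(Vf)=\varphi(n,a_1,a_2,\dots),$$ where $a_i$ is the number of fixed points of the $i$-th iterate $f^i$. Let $V$ be a finitely generated $\mathcal{F}$-representation. Then the dimension of $V[n]$ coincides with a polynomial for $n\ge 1$: there is $p\in\mathbb{Q}[x]$ with $\dim V[n]=p(n)$ for all $n\ge 1$. Indeed, $V$ has a universal trace-computing polynomial, and every such polynomial $\varphi_V$ satisfies $$\dim V[n]=\varphi_V(n,n,n,\dots)\qquad\text{for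 all } n\ge 1.$$ -/

import Mathlib

open CategoryTheory

universe v

/-- The category `ℱ`: the full subcategory of sets on the finite sets `[0], [1], [2], …`,
with all functions as morphisms (Mathlib's skeleton of the category of finite sets;
`[n]` is realized as `ULift (Fin n)`). -/
abbrev FinCat : Type := FintypeCat.Skeleton.{0}

/-- The object `[n]` of `ℱ`. -/
abbrev FinCat.ofNat (n : ℕ) : FinCat := FintypeCat.Skeleton.mk n

/-- The function `{0, …, m-1} → {0, …, n-1}` underlying a morphism `[m] → [n]` of `ℱ`. -/
def FinCat.toFun {m n : ℕ} (f : FinCat.ofNat m ⟶ FinCat.ofNat n) : Fin m → Fin n :=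
  fun i => (f (ULift.up i)).down

/-- An `ℱ`-representation: a functor from `ℱ` to finite-dimensional `ℚ`-vector spaces. -/
abbrev FRep : Type (max 1 (v + 1)) :=
  FinCat ⥤ FGModuleCat.{v} ℚ

namespace FRep

/-- The vector space `V[n]`. -/
abbrev space (V : FRep.{v}) (n : ℕ) : FGModuleCat.{v} ℚ := V.obj (FinCat.ofNat n)

/-- The linear map `V f : V[m] → V[n]` induced by a function `f : [m] → [n]`. -/
abbrev act (V : FRep.{v}) {m n : ℕ} (f : FinCat.ofNat m ⟶ FinCat.ofNat n) :
    V.space m →ₗ[ℚ] V.space n :=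
  (V.map f).hom.hom

/-- `V` is finitely generated: there are finitely many vectors `xᵢ ∈ V[kᵢ]` such that every
`V[n]` is spanned by the images `(V f) xᵢ` over all `i` and all functions `f : [kᵢ] → [n]`. -/
def IsFinitelyGenerated (V : FRep.{v}) : Prop :=
  ∃ S : Set (Σ k : ℕ, V.space k), S.Finite ∧ ∀ n : ℕ,
    Submodule.span ℚ
      {y : V.space n | ∃ x ∈ S, ∃ f : FinCat.ofNat x.1 ⟶ FinCat.ofNat n, y = V.act f x.2} = ⊤

end FRep

/-- The arguments `(n, a₁, a₂, a₃, …)` attached to an endomorphism `f` of `[n]`, where `aᵢ` is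
the number of fixed points of the `i`-th iterate of `f`. -/
noncomputable def fixedPointCount {n : ℕ} (f : FinCat.ofNat n ⟶ FinCat.ofNat n) : ℕ → ℕ
  | 0 => n
  | i + 1 => Set.ncard (Function.fixedPoints ((FinCat.toFun f)^[i + 1]))

/-- `φ(x₀, x₁, x₂, …)` is a universal trace-computing polynomial of `V`: for every endomorphism `f`
of a set of size `n > 0`, the trace of `V f` is `φ(n, a₁, a₂, …)`, with `aᵢ` the number of
fixed points of the `i`-th iterate of `f`. -/
def IsTracePolynomial (V : FRep.{v}) (φ : MvPolynomial ℕ ℚ) : Prop :=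
  ∀ n : ℕ, 0 < n → ∀ f : FinCat.ofNat n ⟶ FinCat.ofNat n,
    LinearMap.trace ℚ (V.space n) (V.act f) =
      MvPolynomial.eval (fun i => (fixedPointCount f i : ℚ)) φ

/-! The proof inducts on a strict bound `k` for the degrees of generators. The difference functor
DV(X) = V(X ⊔ {*}) / V(X) lowers the bound by one. For nonempty X the inclusion V(X) → V(X ⊔ {*})
splits, so with f₊ extending f by a fixed base point, Tr V(f) = Tr V(f₊) - Tr DV(f). It remains to
compute Tr V(f₊) (`trace_addPoint`).

On pointed sets, inclusion-exclusion over collapsing maps gives idempotents e_S, indexed by sets S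
of non-base points, that sum to the identity and vanish for |S| ≥ k. The trace of V(f₊) e_S is zero
unless f permutes S, and then depends only on that permutation. Hence Tr V(f₊) is a finite
combination, over j < k and permutations π of j points, of the numbers of injections g with gπ = fg.

Without injectivity, such g are counted by a product over the cycles of π: a cycle of length l
contributes the number of fixed points of f^l. Sorting by kernels then isolates the injective ones
(`card_injective_equivariant_aux`). -/

/-! ### Counting equivariant maps by fixed points of iterates -/

/-- The number of fixed points of the `i`-th iterate of `f`. -/
noncomputable def iterateFixedCount {n : ℕ} (f : Fin n → Fin n) (i : ℕ) : ℚ :=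
  (Nat.card (Function.fixedPoints f^[i]) : ℚ)

/-- A rational function of endomaps of finite sets which is a polynomial in the numbers of
fixed points of the iterates. -/
def IsFixedCountPolynomial (F : ∀ n : ℕ, (Fin n → Fin n) → ℚ) : Prop :=
  ∃ φ : MvPolynomial ℕ ℚ, ∀ n (f : Fin n → Fin n),
    F n f = MvPolynomial.eval (iterateFixedCount f) φ

namespace IsFixedCountPolynomial

variable {F G : ∀ n : ℕ, (Fin n → Fin n) → ℚ}

theorem const (c : ℚ) : IsFixedCountPolynomial fun _ _ => c :=
  ⟨MvPolynomial.C c, fun n f => by simp⟩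

theorem sub (hF : IsFixedCountPolynomial F) (hG : IsFixedCountPolynomial G) :
    IsFixedCountPolynomial fun n f => F n f - G n f := by
  obtain ⟨φ, hφ⟩ := hF
  obtain ⟨ψ, hψ⟩ := hG
  exact ⟨φ - ψ, fun n f => by simp [hφ, hψ]⟩

theorem const_mul (c : ℚ) (hF : IsFixedCountPolynomial F) :
    IsFixedCountPolynomial fun n f => c * F n f := by
  obtain ⟨φ, hφ⟩ := hF
  exact ⟨MvPolynomial.C c * φ, fun n f => by simp [hφ]⟩

theorem sum {ι : Type*} (s : Finset ι) {F : ι → ∀ n : ℕ, (Fin n → Fin n) → ℚ}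
    (hF : ∀ i ∈ s, IsFixedCountPolynomial (F i)) :
    IsFixedCountPolynomial fun n f => ∑ i ∈ s, F i n f := by
  choose! φ hφ using hF
  refine ⟨∑ i ∈ s, φ i, fun n f => ?_⟩
  rw [map_sum]
  exact Finset.sum_congr rfl fun i hi => hφ i hi n f

end IsFixedCountPolynomial

/-- Maps from a permutation `π` to an endomap `f` are determined by the images of
representatives of the cycles of `π`. -/
theorem card_equivariant {A : Type} [Finite A] (π : Equiv.Perm A) :
    IsFixedCountPolynomial fun n f => (Nat.card {g : A → Fin n // ∀ a, g (π a) = f (g a)} : ℚ) := by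
  classical
  let _ : Fintype (Quotient (Equiv.Perm.SameCycle.setoid π)) := Fintype.ofFinite _
  let r : A → Quotient (Equiv.Perm.SameCycle.setoid π) := fun a => Quotient.mk _ a
  have hk : ∀ a, ∃ k : ℕ, π^[k] (r a).out = a := by
    intro a
    have h : π.SameCycle (r a).out a := Quotient.mk_out (s := Equiv.Perm.SameCycle.setoid π) a
    obtain ⟨k, -, hk⟩ := h.exists_pow_eq'
    exact ⟨k, by rw [← Equiv.Perm.coe_pow, hk]⟩
  choose k hk using hk
  have hr : ∀ a, r (π a) = r a := fun a =>
    Quotient.sound (s := Equiv.Perm.SameCycle.setoid π) ((Equiv.Perm.SameCycle.refl π a).apply_left)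
  refine ⟨∏ ω : Quotient (Equiv.Perm.SameCycle.setoid π),
    MvPolynomial.X (Function.minimalPeriod π ω.out), fun n f => ?_⟩
  have hiter : ∀ {g : A → Fin n}, (∀ a, g (π a) = f (g a)) → ∀ i a, g (π^[i] a) = f^[i] (g a) :=
    fun {g} hg i a => (Function.Semiconj.iterate_right (f := g) (ga := π) (gb := f) hg i) a
  -- The exponents `k` are arbitrary choices, well defined only modulo the cycle length; this makes
  -- them harmless.
  have hmod : ∀ (a : A) (y : Fin n) (i j : ℕ), f^[Function.minimalPeriod π a] y = y →
      π^[i] a = π^[j] a → f^[i] y = f^[j] y := by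
    intro a y i j hy hij
    have hp : 0 < Function.minimalPeriod π a :=
      Function.minimalPeriod_pos_of_mem_periodicPts
        (Function.Injective.mem_periodicPts π.injective a)
    rw [← Function.iterate_mod_minimalPeriod_eq (n := i),
      ← Function.iterate_mod_minimalPeriod_eq (n := j),
      Function.iterate_eq_iterate_iff_of_lt_minimalPeriod (Nat.mod_lt _ hp) (Nat.mod_lt _ hp)]
      at hij
    have hy' : Function.IsPeriodicPt f (Function.minimalPeriod π a) y := hy
    rw [← hy'.iterate_mod_apply i, ← hy'.iterate_mod_apply j, hij]
  let e : {g : A → Fin n // ∀ a, g (π a) = f (g a)} ≃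
      ∀ ω : Quotient (Equiv.Perm.SameCycle.setoid π),
        Function.fixedPoints f^[Function.minimalPeriod π ω.out] :=
    { toFun := fun g ω => ⟨g.1 ω.out, by
        rw [Function.mem_fixedPoints, Function.IsFixedPt, ← hiter g.2,
          Function.iterate_minimalPeriod]⟩
      invFun := fun y => ⟨fun a => f^[k a] (y (r a)).1, fun a => by
        change f^[k (π a)] (y (r (π a))).1 = f (f^[k a] (y (r a)).1)
        rw [← Function.iterate_succ_apply' f, hr a]
        refine hmod (r a).out _ _ _ (y (r a)).2 ?_
        rw [Function.iterate_succ_apply', hk, ← hr a, hk]⟩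
      left_inv := fun g => by
        ext1
        funext a
        change f^[k a] (g.1 (r a).out) = g.1 a
        rw [← hiter g.2, hk]
      right_inv := fun y => by
        funext ω
        have hω : r ω.out = ω := Quotient.out_eq ω
        ext1
        change f^[k ω.out] (y (r ω.out)).1 = (y ω).1
        have h2 := hk ω.out
        rw [hω] at h2 ⊢
        exact hmod ω.out _ _ 0 (y ω).2 h2 }
  beta_reduce
  rw [Nat.card_congr e, Nat.card_pi]
  simp [iterateFixedCount]

/-- Equivariant maps with kernel r are the injective equivariant maps from the quotient by r. Strong
induction on the cardinality therefore handles every r ≠ ⊥, and subtracting these from the count of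
all equivariant maps leaves the injective ones. -/
theorem card_injective_equivariant_aux (N : ℕ) : ∀ {A : Type} [Finite A] (π : Equiv.Perm A),
    Nat.card A = N → IsFixedCountPolynomial fun n f =>
      (Nat.card {g : A → Fin n // Function.Injective g ∧ ∀ a, g (π a) = f (g a)} : ℚ) := by
  induction N using Nat.strong_induction_on with
  | _ N ih =>
  intro A _ π hA
  classical
  have : Finite (Setoid A) := Finite.of_injective (fun r : Setoid A => fun a b => r a b)
    fun r s h => Setoid.ext fun a b => iff_of_eq (congrFun (congrFun h a) b)
  let _ : Fintype (Setoid A) := Fintype.ofFinite _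
  let c : Setoid A → ∀ n : ℕ, (Fin n → Fin n) → ℚ := fun r n f =>
    (Nat.card {g : A → Fin n // (∀ a, g (π a) = f (g a)) ∧ Setoid.ker g = r} : ℚ)
  have htotal : ∀ n (f : Fin n → Fin n),
      (Nat.card {g : A → Fin n // ∀ a, g (π a) = f (g a)} : ℚ) = ∑ r, c r n f := by
    intro n f
    rw [← Nat.cast_sum, ← Nat.card_sigma]
    congr 1
    exact Nat.card_congr
      { toFun := fun g => ⟨Setoid.ker g.1, g.1, g.2, rfl⟩
        invFun := fun x => ⟨x.2.1, x.2.2.1⟩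
        left_inv := fun g => rfl
        right_inv := by rintro ⟨r, g, hg, rfl⟩; rfl }
  have hc : ∀ r : Setoid A, r ≠ ⊥ → IsFixedCountPolynomial (c r) := by
    intro r hr
    by_cases hinv : ∀ a b, r a b → r (π a) (π b)
    · let q : Quotient r → Quotient r := Quotient.map π hinv
      have hq : Function.Surjective q := by
        intro x
        induction x using Quotient.inductionOn with
        | _ a => exact ⟨Quotient.mk r (π.symm a), by simp [q]⟩
      have hlt : Nat.card (Quotient r) < N := by
        rw [← hA]
        refine lt_of_le_of_ne (Nat.card_le_card_of_surjective _ Quotient.mk_surjective) ?_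
        intro h
        apply hr
        have hb := (Nat.bijective_iff_surjective_and_card (Quotient.mk r)).2
          ⟨Quotient.mk_surjective, h.symm⟩
        ext a b
        exact ⟨fun hab => hb.1 (Quotient.sound hab), fun hab => by
          have : a = b := hab
          rw [this]⟩
      obtain ⟨φ, hφ⟩ := ih _ hlt (Equiv.ofBijective q
        ⟨Finite.injective_iff_surjective.2 hq, hq⟩) rfl
      refine ⟨φ, fun n f => ?_⟩
      rw [← hφ n f]
      change ((Nat.card _ : ℕ) : ℚ) = _
      congr 1
      exact Nat.card_congr
        { toFun := fun g => ⟨Quotient.lift g.1 fun a b hab => by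
              have h : (Setoid.ker g.1) a b := by rw [g.2.2]; exact hab
              exact h, by
            constructor
            · intro x y
              induction x, y using Quotient.inductionOn₂ with
              | _ a b =>
              intro hab
              refine Quotient.sound ?_
              have h : (Setoid.ker g.1) a b := hab
              rw [g.2.2] at h
              exact h
            · intro x
              induction x using Quotient.inductionOn with
              | _ a => exact g.2.1 a⟩
          invFun := fun h => ⟨fun a => h.1 (Quotient.mk r a), fun a => h.2.2 (Quotient.mk r a), by
            ext a b
            exact ⟨fun hab => Quotient.exact (h.2.1 hab),
              fun hab => congrArg h.1 (Quotient.sound hab)⟩⟩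
          left_inv := fun g => rfl
          right_inv := fun h => by
            ext1
            funext x
            induction x using Quotient.inductionOn with
            | _ a => rfl }
    -- The kernel of an equivariant map is π-invariant, so no map has kernel r here.
    · convert IsFixedCountPolynomial.const 0 using 3 with n f
      have : IsEmpty {g : A → Fin n // (∀ a, g (π a) = f (g a)) ∧ Setoid.ker g = r} := by
        refine ⟨fun g => hinv fun a b hab => ?_⟩
        obtain ⟨g, hg, rfl⟩ := g
        change g (π a) = g (π b)
        rw [hg, hg, show g a = g b from hab]
      simp [c]
  have key := (card_equivariant π).sub
    (IsFixedCountPolynomial.sum (Finset.univ.erase (⊥ : Setoid A)) (F := c)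
      fun r hr => hc r (Finset.ne_of_mem_erase hr))
  convert key using 3 with n f
  rw [htotal, ← Finset.add_sum_erase _ _ (Finset.mem_univ (⊥ : Setoid A)), add_sub_cancel_right]
  change _ = ((Nat.card _ : ℕ) : ℚ)
  congr 1
  refine Nat.card_congr (Equiv.subtypeEquivRight fun g => ?_)
  rw [and_comm, Setoid.injective_iff_ker_bot]

theorem card_injective_equivariant {A : Type} [Finite A] (π : Equiv.Perm A) :
    IsFixedCountPolynomial fun n f =>
      (Nat.card {g : A → Fin n // Function.Injective g ∧ ∀ a, g (π a) = f (g a)} : ℚ) :=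
  card_injective_equivariant_aux _ π rfl

/-! ### Pointed sets and cross effects -/

theorem linearMap_sum_comp {ι M N P : Type*} [AddCommGroup M] [Module ℚ M] [AddCommGroup N]
    [Module ℚ N] [AddCommGroup P] [Module ℚ P] (s : Finset ι) (f : ι → N →ₗ[ℚ] P)
    (g : M →ₗ[ℚ] N) : (∑ i ∈ s, f i) ∘ₗ g = ∑ i ∈ s, f i ∘ₗ g := by
  ext x
  simp [LinearMap.sum_apply]

theorem linearMap_comp_sum {ι M N P : Type*} [AddCommGroup M] [Module ℚ M] [AddCommGroup N]
    [Module ℚ N] [AddCommGroup P] [Module ℚ P] (s : Finset ι) (f : ι → M →ₗ[ℚ] N)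
    (g : N →ₗ[ℚ] P) : g ∘ₗ (∑ i ∈ s, f i) = ∑ i ∈ s, g ∘ₗ f i := by
  ext x
  simp [LinearMap.sum_apply]

/-- A functor from the finite sets `Fin n` to finite-dimensional rational vector spaces. -/
structure FinSetModule where
  /-- the value on `Fin n` -/
  obj : ℕ → Type v
  [addCommGroup : ∀ n, AddCommGroup (obj n)]
  [module : ∀ n, Module ℚ (obj n)]
  [finite : ∀ n, Module.Finite ℚ (obj n)]
  /-- the action of a function -/
  map : ∀ {m n : ℕ}, (Fin m → Fin n) → obj m →ₗ[ℚ] obj n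
  map_id : ∀ n, map (id : Fin n → Fin n) = LinearMap.id
  map_comp : ∀ {l m n : ℕ} (g : Fin m → Fin n) (f : Fin l → Fin m), map (g ∘ f) = map g ∘ₗ map f

namespace FinSetModule

attribute [instance] addCommGroup module finite

/-- Extension of a function by a fixed base point. -/
def addPoint {m n : ℕ} (f : Fin m → Fin n) : Fin (m + 1) → Fin (n + 1) :=
  Fin.cons 0 (Fin.succ ∘ f)

@[simp] theorem addPoint_zero {m n : ℕ} (f : Fin m → Fin n) : addPoint f 0 = 0 := rfl

@[simp] theorem addPoint_succ {m n : ℕ} (f : Fin m → Fin n) (i : Fin m) :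
    addPoint f i.succ = (f i).succ := rfl

theorem addPoint_id (n : ℕ) : addPoint (id : Fin n → Fin n) = id := by
  funext i
  cases i using Fin.cases <;> rfl

theorem addPoint_comp {l m n : ℕ} (g : Fin m → Fin n) (f : Fin l → Fin m) :
    addPoint (g ∘ f) = addPoint g ∘ addPoint f := by
  funext i
  cases i using Fin.cases <;> rfl

/-- The map that fixes the points of `S` and sends all others to the base point. -/
def collapse {n : ℕ} (S : Finset (Fin n)) : Fin (n + 1) → Fin (n + 1) :=
  Fin.cons 0 fun i => if i ∈ S then i.succ else 0

@[simp] theorem collapse_zero {n : ℕ} (S : Finset (Fin n)) : collapse S 0 = 0 := rfl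

@[simp] theorem collapse_succ {n : ℕ} (S : Finset (Fin n)) (i : Fin n) :
    collapse S i.succ = if i ∈ S then i.succ else 0 := rfl

theorem collapse_univ (n : ℕ) : collapse (Finset.univ : Finset (Fin n)) = id := by
  funext i
  cases i using Fin.cases <;> simp

theorem collapse_comp_collapse {n : ℕ} (S T : Finset (Fin n)) :
    collapse S ∘ collapse T = collapse (S ∩ T) := by
  funext i
  cases i using Fin.cases with
  | zero => simp
  | succ i => by_cases hS : i ∈ S <;> by_cases hT : i ∈ T <;> simp [hS, hT]

variable (V : FinSetModule.{v})

theorem map_map {l m n : ℕ} (g : Fin m → Fin n) (f : Fin l → Fin m) (x : V.obj l) :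
    V.map g (V.map f x) = V.map (g ∘ f) x := by
  rw [V.map_comp]; rfl

/-- The cross effect projector of a pointed set `Fin (n + 1)` at a set `S` of
non-base points. -/
def crossEffect {n : ℕ} (S : Finset (Fin n)) : V.obj (n + 1) →ₗ[ℚ] V.obj (n + 1) :=
  ∑ U ∈ S.powerset, (-1 : ℚ) ^ (S.card - U.card) • V.map (collapse U)

variable {V}

/-- The terms for U and U ∪ {s} cancel: the two collapses differ only at s, which g misses. -/
theorem crossEffect_comp_map_eq_zero {m n : ℕ} {S : Finset (Fin n)} (g : Fin m → Fin (n + 1))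
    {s : Fin n} (hs : s ∈ S) (hg : ∀ i, g i ≠ s.succ) : V.crossEffect S ∘ₗ V.map g = 0 := by
  have hU : ∀ U : Finset (Fin n), collapse (insert s U) ∘ g = collapse U ∘ g := by
    intro U
    funext i
    simp only [Function.comp_apply]
    have := hg i
    generalize g i = x at this
    cases x using Fin.cases with
    | zero => simp
    | succ j =>
      have hj : j ≠ s := fun h => this (by rw [h])
      simp [hj]
  rw [crossEffect, linearMap_sum_comp, ← Finset.insert_erase hs,
    Finset.sum_powerset_insert (Finset.notMem_erase s S), ← Finset.sum_add_distrib]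
  refine Finset.sum_eq_zero fun U hUS => ?_
  rw [Finset.mem_powerset] at hUS
  have hsU : s ∉ U := fun h => Finset.notMem_erase s S (hUS h)
  have hle := Finset.card_le_card hUS
  rw [Finset.card_insert_of_notMem hsU, Finset.card_insert_of_notMem (Finset.notMem_erase s S),
    LinearMap.smul_comp, LinearMap.smul_comp, ← V.map_comp, ← V.map_comp, hU, Nat.add_sub_add_right,
    Nat.succ_sub hle, pow_succ]
  module

theorem crossEffect_comp_collapse {n : ℕ} (S : Finset (Fin n)) :
    V.crossEffect S ∘ₗ V.map (collapse S) = V.crossEffect S := by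
  rw [crossEffect, linearMap_sum_comp]
  refine Finset.sum_congr rfl fun U hU => ?_
  rw [LinearMap.smul_comp, ← V.map_comp, collapse_comp_collapse,
    Finset.inter_eq_left.2 (Finset.mem_powerset.1 hU)]

theorem collapse_comp_crossEffect {n : ℕ} (S : Finset (Fin n)) :
    V.map (collapse S) ∘ₗ V.crossEffect S = V.crossEffect S := by
  rw [crossEffect, linearMap_comp_sum]
  refine Finset.sum_congr rfl fun U hU => ?_
  rw [LinearMap.comp_smul, ← V.map_comp, collapse_comp_collapse,
    Finset.inter_eq_right.2 (Finset.mem_powerset.1 hU)]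

/-- When the right factor is expanded, only U = S survives: for smaller U the collapse misses a
point of S. -/
theorem crossEffect_comp_self {n : ℕ} (S : Finset (Fin n)) :
    V.crossEffect S ∘ₗ V.crossEffect S = V.crossEffect S := by
  conv_lhs => enter [2]; rw [crossEffect]
  rw [linearMap_comp_sum, Finset.sum_eq_single S]
  · simp [crossEffect_comp_collapse]
  · intro U hU hne
    obtain ⟨s, hs, hsU⟩ := Finset.exists_of_ssubset
      (Finset.ssubset_iff_subset_ne.2 ⟨Finset.mem_powerset.1 hU, hne⟩)
    rw [LinearMap.comp_smul, crossEffect_comp_map_eq_zero _ hs, smul_zero]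
    intro i
    cases i using Fin.cases with
    | zero => simpa using (Fin.succ_ne_zero s).symm
    | succ i =>
      by_cases hi : i ∈ U
      · simp only [collapse_succ, hi, if_true, ne_eq, Fin.succ_inj]
        rintro rfl
        exact hsU hi
      · simpa [hi] using (Fin.succ_ne_zero s).symm
  · intro h
    exact absurd (Finset.mem_powerset_self S) h

/-- Möbius inversion: the coefficient of `collapse U` is an alternating sum over S ⊇ U, zero unless
U is everything. -/
theorem sum_crossEffect (n : ℕ) :
    ∑ S : Finset (Fin n), V.crossEffect S = LinearMap.id := by
  simp only [crossEffect]
  have h : ∀ S : Finset (Fin n), ∑ U ∈ S.powerset, (-1 : ℚ) ^ (S.card - U.card) •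
      V.map (collapse U) = ∑ U, if U ⊆ S then (-1 : ℚ) ^ (S.card - U.card) •
      V.map (collapse U) else 0 := by
    intro S
    rw [← Finset.sum_filter]
    congr 1
    ext U
    simp
  simp only [h]
  rw [Finset.sum_comm, Finset.sum_eq_single Finset.univ]
  · rw [Finset.sum_eq_single Finset.univ]
    · simp [collapse_univ, V.map_id]
    · intro S _ hS
      rw [if_neg]
      rwa [Finset.univ_subset_iff]
    · simp
  · intro U _ hU
    have hz : ∑ S : Finset (Fin n), (if U ⊆ S then (-1 : ℚ) ^ (S.card - U.card) else 0) = 0 := by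
      have h1 := Finset.sum_powerset_neg_one_pow_card_of_nonempty (x := Uᶜ)
        (by rwa [Finset.nonempty_iff_ne_empty, ne_eq, Finset.compl_eq_empty_iff])
      have h2 : ((∑ W ∈ Uᶜ.powerset, (-1 : ℤ) ^ W.card : ℤ) : ℚ) = 0 := by rw [h1]; rfl
      push_cast at h2
      rw [← Finset.sum_filter]
      refine Eq.trans (Eq.symm ?_) h2
      refine Finset.sum_bij' (fun W _ => U ∪ W) (fun S _ => S \ U) ?_ ?_ ?_ ?_ ?_
      · intro W _; simp
      · intro S _
        rw [Finset.mem_powerset]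
        intro x hx
        simpa using (Finset.mem_sdiff.1 hx).2
      · intro W hW
        rw [Finset.mem_powerset] at hW
        ext x
        have := @hW x
        simp only [Finset.mem_compl] at this
        simp only [Finset.mem_sdiff, Finset.mem_union]
        tauto
      · intro S hS
        simp only [Finset.mem_filter, Finset.mem_univ, true_and] at hS
        exact Finset.union_sdiff_of_subset hS
      · intro W hW
        rw [Finset.mem_powerset] at hW
        rw [Finset.card_union_of_disjoint, Nat.add_sub_cancel_left]
        exact (Finset.subset_compl_iff_disjoint_left.1 hW)
    refine Eq.trans ?_ ((congrArg (· • V.map (collapse U)) hz).trans (zero_smul ℚ _))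
    rw [Finset.sum_smul]
    refine Finset.sum_congr rfl fun S _ => ?_
    split_ifs <;> simp
  · simp

variable (V) in
/-- `V` is generated by its values on sets with fewer than `k` elements. -/
def GeneratedBelow (k : ℕ) : Prop :=
  ∀ n, Submodule.span ℚ {y : V.obj n | ∃ m < k, ∃ (f : Fin m → Fin n) (x : V.obj m),
    V.map f x = y} = ⊤

theorem GeneratedBelow.linearMap_ext {k : ℕ} (hV : V.GeneratedBelow k) {n : ℕ} {M : Type*}
    [AddCommGroup M] [Module ℚ M] {a b : V.obj n →ₗ[ℚ] M}
    (h : ∀ m < k, ∀ f : Fin m → Fin n, a ∘ₗ V.map f = b ∘ₗ V.map f) : a = b := by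
  refine LinearMap.ext_on (hV n) ?_
  rintro _ ⟨m, hm, f, x, rfl⟩
  exact LinearMap.congr_fun (h m hm f) x

/-- A map from fewer than k points cannot cover S, so the projector kills every generator. -/
theorem GeneratedBelow.crossEffect_eq_zero {k : ℕ} (hV : V.GeneratedBelow k) {n : ℕ}
    {S : Finset (Fin n)} (hS : k ≤ S.card) : V.crossEffect S = 0 := by
  refine hV.linearMap_ext fun m hm g => ?_
  have : ¬ S.map (Fin.succEmb n) ⊆ Finset.univ.image g := by
    intro h
    have h1 := (Finset.card_le_card h).trans Finset.card_image_le
    simp at h1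
    omega
  rw [Finset.not_subset] at this
  obtain ⟨x, hx, hxg⟩ := this
  obtain ⟨s, hs, rfl⟩ := Finset.mem_map.1 hx
  rw [crossEffect_comp_map_eq_zero g hs, LinearMap.zero_comp]
  intro i hi
  exact hxg (Finset.mem_image.2 ⟨i, Finset.mem_univ _, hi⟩)

/-! ### Traces on cross effects -/

/-- The trace of a pointed map on the cross effect at `S`. -/
noncomputable def crossTrace (V : FinSetModule.{v}) {n : ℕ} (f : Fin n → Fin n)
    (S : Finset (Fin n)) : ℚ :=
  LinearMap.trace ℚ _ (V.map (addPoint f) ∘ₗ V.crossEffect S)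

/-- By idempotency and cyclicity the trace is that of e_S V(f₊) e_S, and e_S absorbs a collapse onto
S. The map f₊ after this collapse misses a point of S, so e_S kills it. -/
theorem crossTrace_eq_zero {n : ℕ} (f : Fin n → Fin n) {S : Finset (Fin n)}
    (hS : ¬ S ⊆ S.image f) : V.crossTrace f S = 0 := by
  obtain ⟨s, hs, hsf⟩ := Finset.not_subset.1 hS
  rw [crossTrace, ← crossEffect_comp_self, ← LinearMap.comp_assoc, LinearMap.trace_comp_comm',
    ← collapse_comp_crossEffect S, ← LinearMap.comp_assoc, ← LinearMap.comp_assoc,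
    collapse_comp_crossEffect S, LinearMap.comp_assoc (V.map (collapse S)), ← V.map_comp,
    crossEffect_comp_map_eq_zero _ hs, LinearMap.zero_comp, map_zero]
  intro i
  cases i using Fin.cases with
  | zero => simpa using (Fin.succ_ne_zero s).symm
  | succ i =>
    by_cases hi : i ∈ S
    · simp only [Function.comp_apply, collapse_succ, hi, if_true, addPoint_succ, ne_eq,
        Fin.succ_inj]
      rintro rfl
      exact hsf (Finset.mem_image_of_mem f hi)
    · simpa [hi] using (Fin.succ_ne_zero s).symm

theorem trace_addPoint {k : ℕ} (hV : V.GeneratedBelow k) {n : ℕ} (f : Fin n → Fin n) :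
    LinearMap.trace ℚ _ (V.map (addPoint f)) =
      ∑ j ∈ Finset.range k, ∑ S ∈ Finset.powersetCard j Finset.univ, V.crossTrace f S := by
  have h1 : LinearMap.trace ℚ _ (V.map (addPoint f)) = ∑ S, V.crossTrace f S := by
    conv_lhs => rw [← LinearMap.comp_id (V.map (addPoint f)), ← sum_crossEffect, linearMap_comp_sum,
      map_sum]
    rfl
  rw [h1, ← Finset.sum_filter_of_ne (p := fun S => S.card < k)]
  · rw [← Finset.sum_fiberwise_of_maps_to (g := Finset.card) (t := Finset.range k)]
    · refine Finset.sum_congr rfl fun j hj => Finset.sum_congr ?_ fun _ _ => rfl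
      ext S
      simp only [Finset.mem_filter, Finset.mem_univ, true_and, Finset.mem_powersetCard,
        Finset.subset_univ]
      have := Finset.mem_range.1 hj
      omega
    · intro S hS
      simpa using hS
  · intro S _ hne
    by_contra hS
    rw [crossTrace, hV.crossEffect_eq_zero (not_lt.1 hS)] at hne
    simp at hne

/-- Here p is the retraction of `addPoint g` that sends points outside the range of g to the base
point. It transports the projector at the image of g to the top projector on j points. -/
theorem crossEffect_map {j n : ℕ} (g : Fin j ↪ Fin n) (p : Fin (n + 1) → Fin (j + 1))
    (hp0 : p 0 = 0) (hp : ∀ i, p (g i).succ = i.succ) (hp' : ∀ i ∉ Set.range g, p i.succ = 0) :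
    V.crossEffect (Finset.univ.map g) =
      V.map (addPoint g) ∘ₗ V.crossEffect Finset.univ ∘ₗ V.map p := by
  have hpow : (Finset.univ.map g).powerset =
      (Finset.univ : Finset (Fin j)).powerset.map (Finset.mapEmbedding g).toEmbedding := by
    ext U
    simp only [Finset.mem_powerset, Finset.mem_map, RelEmbedding.coe_toEmbedding,
      Finset.mapEmbedding_apply, Finset.subset_map_iff]
    constructor
    · rintro ⟨W, hW, rfl⟩; exact ⟨W, hW, rfl⟩
    · rintro ⟨W, hW, rfl⟩; exact ⟨W, hW, rfl⟩
  rw [crossEffect, hpow, Finset.sum_map, crossEffect, linearMap_sum_comp, linearMap_comp_sum]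
  refine Finset.sum_congr rfl fun U _ => ?_
  simp only [RelEmbedding.coe_toEmbedding, Finset.mapEmbedding_apply, Finset.card_map,
    LinearMap.smul_comp, LinearMap.comp_smul, ← V.map_comp]
  congr 2
  funext i
  cases i using Fin.cases with
  | zero => simp [hp0]
  | succ i =>
    by_cases hi : i ∈ Set.range g
    · obtain ⟨i, rfl⟩ := hi
      by_cases hU : i ∈ U <;> simp [hp, hU]
    · have : i ∉ U.map g := fun h => by
        obtain ⟨a, -, rfl⟩ := Finset.mem_map.1 h
        exact hi ⟨a, rfl⟩
      simp [hp' i hi, this]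

theorem crossTrace_map {j n : ℕ} (f : Fin n → Fin n) (g : Fin j ↪ Fin n)
    (π : Fin j → Fin j) (h : ∀ i, g (π i) = f (g i)) :
    V.crossTrace f (Finset.univ.map g) = V.crossTrace π Finset.univ := by
  classical
  let p : Fin (n + 1) → Fin (j + 1) := Fin.cons 0 fun i =>
    if hi : i ∈ Set.range g then hi.choose.succ else 0
  have hp : ∀ i, p (g i).succ = i.succ := by
    intro i
    have hi : g i ∈ Set.range g := ⟨i, rfl⟩
    simp only [p, Fin.cons_succ, hi, dif_pos]
    rw [g.injective hi.choose_spec]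
  have hp' : ∀ i ∉ Set.range g, p i.succ = 0 := by
    intro i hi
    simp only [p, Fin.cons_succ, hi]
    rfl
  have hpg : p ∘ addPoint g = id := by
    funext i
    cases i using Fin.cases with
    | zero => rfl
    | succ i => simp [hp]
  have hfg : addPoint f ∘ addPoint g = addPoint g ∘ addPoint π := by
    rw [← addPoint_comp, ← addPoint_comp]
    congr 1
    funext i
    exact (h i).symm
  rw [crossTrace, crossEffect_map g p rfl hp hp', ← LinearMap.comp_assoc, ← V.map_comp, hfg,
    ← LinearMap.comp_assoc, LinearMap.trace_comp_comm', ← LinearMap.comp_assoc, ← V.map_comp,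
    ← Function.comp_assoc, hpg, Function.id_comp]
  rfl

end FinSetModule

namespace FinSetModule

variable {V : FinSetModule.{v}}

theorem card_embedding_map_eq {j n : ℕ} {S : Finset (Fin n)} (hS : S.card = j) :
    (Finset.univ.filter fun g : Fin j ↪ Fin n => Finset.univ.map g = S).card = j.factorial := by
  classical
  have e : {g : Fin j ↪ Fin n // Finset.univ.map g = S} ≃ (Fin j ≃ S) :=
    { toFun := fun g => Equiv.ofBijective
        (fun i => ⟨g.1 i, g.2.subset (Finset.mem_map_of_mem g.1 (Finset.mem_univ i))⟩)
        ⟨fun a b hab => g.1.injective (congrArg Subtype.val hab), fun s => by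
          obtain ⟨s, hs⟩ := s
          have hs' := hs
          rw [← g.2] at hs'
          obtain ⟨i, -, rfl⟩ := Finset.mem_map.1 hs'
          exact ⟨i, rfl⟩⟩
      invFun := fun e => ⟨e.toEmbedding.trans (Function.Embedding.subtype _), by
        ext x
        simp only [Finset.mem_map, Finset.mem_univ, true_and]
        constructor
        · rintro ⟨i, rfl⟩; exact (e i).2
        · intro hx; exact ⟨e.symm ⟨x, hx⟩, by simp⟩⟩
      left_inv := fun g => rfl
      right_inv := fun e => Equiv.ext fun i => rfl }
  rw [← Fintype.card_subtype, Fintype.card_congr e,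
    Fintype.card_equiv (Fintype.equivOfCardEq (by simp [hS])), Fintype.card_fin]

/-- Injectivity of g allows at most one π, the restriction of f to the image of g. If there is none,
the image is not contained in its own image under f, and both sides vanish. -/
theorem sum_crossTrace_equivariant {j n : ℕ} (f : Fin n → Fin n) (g : Fin j ↪ Fin n) :
    V.crossTrace f (Finset.univ.map g) = ∑ π : Equiv.Perm (Fin j),
      if ∀ i, g (π i) = f (g i) then V.crossTrace π Finset.univ else 0 := by
  classical
  by_cases h : ∃ π : Equiv.Perm (Fin j), ∀ i, g (π i) = f (g i)
  · obtain ⟨π, hπ⟩ := h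
    rw [Finset.sum_eq_single π, if_pos hπ, crossTrace_map f g π hπ]
    · intro σ _ hσ
      rw [if_neg]
      intro hσ'
      exact hσ (Equiv.ext fun i => g.injective ((hσ' i).trans (hπ i).symm))
    · simp
  · rw [Finset.sum_eq_zero, crossTrace_eq_zero]
    · intro hsub
      have heq := Finset.eq_of_subset_of_card_le hsub Finset.card_image_le
      have hex : ∀ i, ∃ i', g i' = f (g i) := by
        intro i
        have : f (g i) ∈ Finset.univ.map g := by
          rw [heq]
          exact Finset.mem_image_of_mem f (Finset.mem_map_of_mem g (Finset.mem_univ i))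
        obtain ⟨i', -, hi'⟩ := Finset.mem_map.1 this
        exact ⟨i', hi'⟩
      choose p hp using hex
      have hsurj : Function.Surjective p := by
        intro i
        obtain ⟨x, hx, hxi⟩ := Finset.mem_image.1
          (hsub (Finset.mem_map_of_mem g (Finset.mem_univ i)))
        obtain ⟨i', -, rfl⟩ := Finset.mem_map.1 hx
        exact ⟨i', g.injective ((hp i').trans hxi)⟩
      exact h ⟨Equiv.ofBijective p ⟨Finite.injective_iff_surjective.2 hsurj, hsurj⟩, hp⟩
    · intro π _
      rw [if_neg fun hπ => h ⟨π, hπ⟩]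

/-- Each j-element set is the image of j! embeddings, so the sum over sets becomes a sum over
embeddings, and the order of summation with π is exchanged. -/
theorem sum_crossTrace_powersetCard {j n : ℕ} (f : Fin n → Fin n) :
    ∑ S ∈ Finset.powersetCard j Finset.univ, V.crossTrace f S =
      (j.factorial : ℚ)⁻¹ * ∑ π : Equiv.Perm (Fin j), V.crossTrace π Finset.univ *
        (Nat.card {g : Fin j → Fin n // Function.Injective g ∧ ∀ i, g (π i) = f (g i)} : ℚ) := by
  classical
  rw [eq_inv_mul_iff_mul_eq₀ (by positivity)]
  have h1 : (j.factorial : ℚ) * ∑ S ∈ Finset.powersetCard j Finset.univ, V.crossTrace f S =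
      ∑ g : Fin j ↪ Fin n, V.crossTrace f (Finset.univ.map g) := by
    rw [← Finset.sum_fiberwise_of_maps_to (s := Finset.univ)
      (g := fun g : Fin j ↪ Fin n => Finset.univ.map g)
      (t := Finset.powersetCard j Finset.univ), Finset.mul_sum]
    · refine Finset.sum_congr rfl fun S hS => ?_
      rw [Finset.sum_congr rfl fun g hg =>
        congrArg (V.crossTrace f) (Finset.mem_filter.1 hg).2, Finset.sum_const,
        card_embedding_map_eq (Finset.mem_powersetCard.1 hS).2, nsmul_eq_mul]
    · intro g _
      simp [Finset.mem_powersetCard]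
  rw [h1, Finset.sum_congr rfl fun g _ => sum_crossTrace_equivariant f g, Finset.sum_comm]
  refine Finset.sum_congr rfl fun π _ => ?_
  rw [← Finset.sum_filter, Finset.sum_const, nsmul_eq_mul, mul_comm, ← Fintype.card_subtype,
    ← Nat.card_eq_fintype_card]
  congr 2
  exact Nat.card_congr
    { toFun := fun g => ⟨g.1, g.1.injective, g.2⟩
      invFun := fun g => ⟨⟨g.1, g.2.1⟩, g.2.2⟩
      left_inv := fun g => rfl
      right_inv := fun g => rfl }

theorem GeneratedBelow.isFixedCountPolynomial_addPoint {k : ℕ} (hV : V.GeneratedBelow k) :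
    IsFixedCountPolynomial fun _ f => LinearMap.trace ℚ _ (V.map (addPoint f)) := by
  simp only [trace_addPoint hV, sum_crossTrace_powersetCard]
  exact IsFixedCountPolynomial.sum _ fun j _ => (IsFixedCountPolynomial.sum _ fun π _ =>
    (card_injective_equivariant π).const_mul _).const_mul _

/-! ### The difference functor and the induction -/

variable (V)

/-- The image of `V` on `Fin n` in `V` on `Fin (n + 1)`. -/
def succRange (n : ℕ) : Submodule ℚ (V.obj (n + 1)) :=
  LinearMap.range (V.map (Fin.succ : Fin n → Fin (n + 1)))

theorem succRange_le_comap {m n : ℕ} (f : Fin m → Fin n) :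
    V.succRange m ≤ (V.succRange n).comap (V.map (addPoint f)) := by
  rintro _ ⟨x, rfl⟩
  exact ⟨V.map f x, by rw [map_map, map_map]; rfl⟩

/-- The difference of `V`: the functor `X ↦ V(X ⊔ {*}) / V(X)`. -/
def difference : FinSetModule.{v} where
  obj n := V.obj (n + 1) ⧸ V.succRange n
  map {m n} f := (V.succRange m).mapQ (V.succRange n) (V.map (addPoint f)) (V.succRange_le_comap f)
  map_id n := by
    refine Submodule.linearMap_qext _ (LinearMap.ext fun x => ?_)
    simp [addPoint_id, V.map_id]
  map_comp g f := by
    refine Submodule.linearMap_qext _ (LinearMap.ext fun x => ?_)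
    simp [addPoint_comp, V.map_comp]

/-- The quotient map to the difference. -/
def toDifference (n : ℕ) : V.obj (n + 1) →ₗ[ℚ] V.difference.obj n :=
  (V.succRange n).mkQ

theorem toDifference_surjective (n : ℕ) : Function.Surjective (V.toDifference n) :=
  (V.succRange n).mkQ_surjective

theorem toDifference_comp_succ (n : ℕ) :
    V.toDifference n ∘ₗ V.map (Fin.succ : Fin n → Fin (n + 1)) = 0 :=
  LinearMap.range_mkQ_comp _

theorem difference_map_toDifference {m n : ℕ} (f : Fin m → Fin n) :
    V.difference.map f ∘ₗ V.toDifference m = V.toDifference n ∘ₗ V.map (addPoint f) :=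
  rfl

theorem trace_addPoint_eq_add {n : ℕ} (hn : 0 < n) (f : Fin n → Fin n) :
    LinearMap.trace ℚ _ (V.map (addPoint f)) =
      LinearMap.trace ℚ _ (V.map f) + LinearMap.trace ℚ _ (V.difference.map f) := by
  let i : V.obj n →ₗ[ℚ] V.obj (n + 1) := V.map Fin.succ
  -- Sending the base point to an existing point of `Fin n` splits `i`; this is where n > 0 is
  -- needed. The splitting need not commute with f, as additivity of the trace does not require it.
  let r : V.obj (n + 1) →ₗ[ℚ] V.obj n := V.map (Fin.cons ⟨0, hn⟩ id)
  have hri : r ∘ₗ i = LinearMap.id := by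
    rw [← V.map_comp, ← V.map_id]
    rfl
  have hfi : V.map (addPoint f) ∘ₗ i = i ∘ₗ V.map f := by
    rw [← V.map_comp, ← V.map_comp]
    rfl
  let q : V.obj (n + 1) →ₗ[ℚ] V.obj (n + 1) := LinearMap.id - i ∘ₗ r
  let s : V.difference.obj n →ₗ[ℚ] V.obj (n + 1) := (V.succRange n).liftQ q (by
    rintro _ ⟨x, rfl⟩
    have := LinearMap.congr_fun hri x
    simp only [LinearMap.comp_apply, LinearMap.id_apply] at this
    change i x - i (r (i x)) = 0
    rw [this, sub_self])
  have hs : s ∘ₗ V.toDifference n = LinearMap.id - i ∘ₗ r := Submodule.liftQ_mkQ _ _ _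
  have hps : V.toDifference n ∘ₗ s = LinearMap.id := by
    refine Submodule.linearMap_qext _ ?_
    change V.toDifference n ∘ₗ (s ∘ₗ V.toDifference n) = V.toDifference n
    rw [hs, LinearMap.comp_sub, ← LinearMap.comp_assoc, V.toDifference_comp_succ]
    simp
  have hid : V.map (addPoint f) =
      (V.map (addPoint f) ∘ₗ i) ∘ₗ r + (V.map (addPoint f) ∘ₗ s) ∘ₗ V.toDifference n := by
    rw [LinearMap.comp_assoc, LinearMap.comp_assoc, ← LinearMap.comp_add, hs]
    simp
  rw [hid, map_add, hfi, LinearMap.trace_comp_comm' r (i ∘ₗ V.map f), ← LinearMap.comp_assoc, hri,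
    LinearMap.id_comp, LinearMap.trace_comp_comm' _ (V.map (addPoint f) ∘ₗ s), ← LinearMap.comp_assoc,
    ← V.difference_map_toDifference, LinearMap.comp_assoc, hps, LinearMap.comp_id]

variable {V}

/-- A generator pushed along g : [m] → [n + 1] dies in the quotient if g avoids the base point.
Otherwise at most m - 1 < k points go elsewhere, and g factors through these points together with a
base point. -/
theorem GeneratedBelow.difference {k : ℕ} (hV : V.GeneratedBelow (k + 1)) :
    V.difference.GeneratedBelow k := by
  classical
  intro n
  rw [eq_top_iff, ← LinearMap.range_eq_top.2 (V.toDifference_surjective n), LinearMap.range_eq_map,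
    ← hV (n + 1), Submodule.map_span_le]
  rintro _ ⟨m, hm, g, x, rfl⟩
  let T : Finset (Fin m) := Finset.univ.filter fun a => g a ≠ 0
  by_cases hT : T = Finset.univ
  · have hg : ∀ a, g a ≠ 0 := fun a => by
      have : a ∈ T := hT ▸ Finset.mem_univ a
      exact (Finset.mem_filter.1 this).2
    have : g = Fin.succ ∘ fun a => (g a).pred (hg a) := by
      funext a
      simp
    rw [this, V.map_comp]
    have h0 := LinearMap.congr_fun (V.toDifference_comp_succ n)
      (V.map (fun a => (g a).pred (hg a)) x)
    rw [LinearMap.comp_apply, LinearMap.zero_apply] at h0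
    rw [LinearMap.comp_apply, h0]
    exact Submodule.zero_mem _
  · have hcard : T.card < k := by
      have := Finset.card_lt_card (Finset.ssubset_univ_iff.2 hT)
      rw [Finset.card_univ, Fintype.card_fin] at this
      omega
    let e := T.equivFin
    have hg : ∀ b, g (e.symm b).1 ≠ 0 := fun b => (Finset.mem_filter.1 (e.symm b).2).2
    let h : Fin T.card → Fin n := fun b => (g (e.symm b).1).pred (hg b)
    let p : Fin m → Fin (T.card + 1) := fun a => if ha : a ∈ T then (e ⟨a, ha⟩).succ else 0
    have hgp : g = addPoint h ∘ p := by
      funext a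
      by_cases ha : a ∈ T
      · simp [p, h, ha]
      · have : g a = 0 := by simpa [T] using ha
        simp [p, ha, this]
    refine Submodule.subset_span ⟨T.card, hcard, h, V.toDifference _ (V.map p x), ?_⟩
    rw [← LinearMap.comp_apply, difference_map_toDifference, LinearMap.comp_apply, map_map, ← hgp]

theorem GeneratedBelow.exists_trace_polynomial {k : ℕ} (hV : V.GeneratedBelow k) :
    ∃ φ : MvPolynomial ℕ ℚ, ∀ n, 0 < n → ∀ f : Fin n → Fin n,
      LinearMap.trace ℚ _ (V.map f) = MvPolynomial.eval (iterateFixedCount f) φ := by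
  induction k generalizing V with
  | zero =>
    refine ⟨0, fun n _ f => ?_⟩
    have : V.map f = 0 := hV.linearMap_ext fun m hm => absurd hm (Nat.not_lt_zero m)
    simp [this]
  | succ k ih =>
    obtain ⟨φ, hφ⟩ := ih hV.difference
    obtain ⟨ψ, hψ⟩ := hV.isFixedCountPolynomial_addPoint
    refine ⟨ψ - φ, fun n hn f => ?_⟩
    rw [map_sub, ← hφ n hn f, ← hψ n f]
    beta_reduce
    rw [V.trace_addPoint_eq_add hn f, add_sub_cancel_right]

end FinSetModule

/-! ### Transfer to ℱ-representations and dimensions -/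

/-- The morphism of `ℱ` with a given underlying function. -/
def FinCat.ofFun {m n : ℕ} (f : Fin m → Fin n) : FinCat.ofNat m ⟶ FinCat.ofNat n :=
  fun i => ULift.up (f i.down)

namespace FRep

/-- The underlying family of vector spaces and linear maps of an `ℱ`-representation. -/
def toFinSetModule (V : FRep.{v}) : FinSetModule.{v} where
  obj n := V.space n
  finite n := inferInstanceAs (Module.Finite ℚ (V.space n))
  map f := V.act (FinCat.ofFun f)
  map_id n := by
    have : FinCat.ofFun (id : Fin n → Fin n) = 𝟙 (FinCat.ofNat n) := rfl
    rw [this, act, V.map_id]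
    rfl
  map_comp g f := by
    have : FinCat.ofFun (g ∘ f) = FinCat.ofFun f ≫ FinCat.ofFun g := rfl
    rw [this, act, V.map_comp]
    rfl

theorem IsFinitelyGenerated.generatedBelow {V : FRep.{v}} (hV : V.IsFinitelyGenerated) :
    ∃ k, V.toFinSetModule.GeneratedBelow k := by
  obtain ⟨S, hS, hspan⟩ := hV
  obtain ⟨k, hk⟩ := (hS.image Sigma.fst).bddAbove
  refine ⟨k + 1, fun n => ?_⟩
  rw [eq_top_iff]
  refine (hspan n).ge.trans (Submodule.span_mono ?_)
  rintro _ ⟨x, hx, f, rfl⟩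
  exact ⟨x.1, Nat.lt_succ_of_le (hk (Set.mem_image_of_mem _ hx)), FinCat.toFun f, x.2, rfl⟩

theorem IsFinitelyGenerated.exists_isTracePolynomial {V : FRep.{v}} (hV : V.IsFinitelyGenerated) :
    ∃ φ, IsTracePolynomial V φ := by
  obtain ⟨k, hk⟩ := hV.generatedBelow
  obtain ⟨φ, hφ⟩ := hk.exists_trace_polynomial
  refine ⟨φ, fun n hn f => ?_⟩
  have hcount : iterateFixedCount (FinCat.toFun f) = fun i => (fixedPointCount f i : ℚ) := by
    funext i
    cases i with
    -- The zeroth iterate is the identity, whose n fixed points match the variable x₀ = n.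
    | zero => simp [iterateFixedCount, fixedPointCount]
    | succ i => rw [iterateFixedCount, fixedPointCount, Nat.card_coe_set_eq]
  rw [← hcount]
  exact hφ n hn (FinCat.toFun f)

end FRep

/-- The dimension is the trace of the identity, all of whose iterates fix n points. -/
theorem IsTracePolynomial.finrank_eq {V : FRep.{v}} {φ : MvPolynomial ℕ ℚ}
    (hφ : IsTracePolynomial V φ) {n : ℕ} (hn : 1 ≤ n) :
    (Module.finrank ℚ (V.space n) : ℚ) = MvPolynomial.eval (fun _ => (n : ℚ)) φ := by
  have h := hφ n hn (𝟙 _)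
  have hact : V.act (𝟙 (FinCat.ofNat n)) = LinearMap.id := by
    rw [FRep.act, V.map_id]
    rfl
  have hcount : ∀ i, fixedPointCount (𝟙 (FinCat.ofNat n)) i = n := by
    intro i
    cases i with
    | zero => rfl
    | succ i =>
      have hid : FinCat.toFun (𝟙 (FinCat.ofNat n)) = id := rfl
      rw [fixedPointCount, hid, Function.iterate_id, Function.fixedPoints_id, Set.ncard_univ,
        Nat.card_eq_fintype_card, Fintype.card_fin]
  simp only [hcount] at h
  rw [hact, LinearMap.trace_id] at h
  exact h

theorem mainTheorem8 (V : FRep.{v}) (hV : V.IsFinitelyGenerated) :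
    (∃ p : Polynomial ℚ, ∀ n : ℕ, 1 ≤ n →
      (Module.finrank ℚ (V.space n) : ℚ) = p.eval (n : ℚ)) ∧
    (∃ φ : MvPolynomial ℕ ℚ, IsTracePolynomial V φ) ∧
    (∀ φ : MvPolynomial ℕ ℚ, IsTracePolynomial V φ → ∀ n : ℕ, 1 ≤ n →
      (Module.finrank ℚ (V.space n) : ℚ) = MvPolynomial.eval (fun _ => (n : ℚ)) φ) := by
  obtain ⟨φ, hφ⟩ := hV.exists_isTracePolynomial
  -- The dimension polynomial arises from φ by replacing every variable with `X`.
  refine ⟨⟨MvPolynomial.aeval (fun _ => Polynomial.X) φ, fun n hn => ?_⟩, ⟨φ, hφ⟩,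
    fun ψ hψ n hn => hψ.finrank_eq hn⟩
  rw [hφ.finrank_eq hn, ← Polynomial.coe_evalRingHom, MvPolynomial.aeval_def,
    MvPolynomial.hom_eval₂]
  have hC : (Polynomial.evalRingHom (n : ℚ)).comp (algebraMap ℚ (Polynomial ℚ)) = RingHom.id ℚ :=
    Subsingleton.elim _ _
  simp only [hC, Polynomial.coe_evalRingHom, Polynomial.eval_X]
  rfl
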